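/- Let $\ell$ be an odd prime number. For a number field $K$ put $\mathcal R_K=\mathbb Z_\ell\otimes_{\mathbb Z}K^\times$ and, for a place $v\mid\ell$, $\mathcal R_{K_v}=\varprojlim_n K_v^\times/K_v^{\times\ell^n}$. Let $\mu_K$ (resp. $\mu_{K_v}$) be the group of roots of unity of $\ell$-power order in $K$ (resp. $K_v$). Let $\mathcal D'_K$ be the free $\mathbb Z_\ell$-module on the prime ideals of $K$ not dividing $\ell$, let $\mathcal R_K^{bp}\subset\mathcal R_K$ be the submodule of the elements whose image in $\mathcal R_{K_v}$ lies in (the image of) $\mu_{K_v}$ for every $v\mid\ell$, and let $\mathcal P_K^{bp}\subset\mathcal D'_K$ be the module of divisors (away from $\ell$) of elements of $\mathcal R_K^{bp}$. Put $\mathcal Cl_K^{bp}=\mathcal D'_K/\mathcal P_K^{bp}$; the Bertrandias–Payan module $\mathcal T_K^{bp}$ is the $\mathbb Z_\ell$-torsion submodule of $\mathcal Cl_K^{bp}$. **Theorem.** Let $K$ be a number field with $\mu_K=1$ and $\mathcal T_K^{bp}\neq1$. Let $L/K$ be an $\ell$-extension (a finite Galois extension whose Galois group is an $\ell$-group) such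 that $L$ satisfies the Leopoldt conjecture for $\ell$, i.e. the natural map $\mathbb Z_\ell\otimes_{\mathbb Z}\mathcal O_L^\times\to\prod_{w\mid\ell}\mathcal R_{L_w}$ is injective. Then $\mu_L=1$ and $\mathcal T_L^{bp}\neq1$; moreover the map $\mathcal T_K^{bp}\to\mathcal T_L^{bp}$ induced by extension of ideals is injective. -/

import Mathlib

open scoped TensorProduct NumberField
open IsDedekindDomain

set_option linter.unusedSectionVars false

noncomputable section

namespace BertrandiasPayan

/-! Notation of the comments: `ℓ` is a prime number, `K` a number field.
All multiplicative `ℤ_ℓ`-modules are written additively. -/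

/-- For a field `F`, the `ℤ_ℓ`-module `ℤ_ℓ ⊗_ℤ F^×`.  For `F = K` this is `R_K`. -/
abbrev AdicMul (ℓ : ℕ) [Fact ℓ.Prime] (F : Type*) [Field F] : Type _ :=
  ℤ_[ℓ] ⊗[ℤ] Additive Fˣ

/-- The map `ℤ_ℓ ⊗ F^× → ℤ_ℓ ⊗ E^×` induced by a field homomorphism `F → E`. -/
def AdicMul.map (ℓ : ℕ) [Fact ℓ.Prime] {F E : Type*} [Field F] [Field E] (f : F →+* E) :
    AdicMul ℓ F →ₗ[ℤ_[ℓ]] AdicMul ℓ E :=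
  (Units.map (f : F →* E)).toAdditive.toIntLinearMap.baseChange ℤ_[ℓ]

/-- The pro-`ℓ`-completion `lim F^× / F^{× ℓ^n}` of the multiplicative group of a field `F`,
as a `ℤ_ℓ`-module: it is the `ℓ`-adic completion of `ℤ_ℓ ⊗ F^×`, whose quotient modulo `ℓ^n` is
`F^× / F^{× ℓ^n}`. -/
abbrev ProMul (ℓ : ℕ) [Fact ℓ.Prime] (F : Type*) [Field F] : Type _ :=
  AdicCompletion (Ideal.span {(ℓ : ℤ_[ℓ])}) (AdicMul ℓ F)

/-- The image in `lim F^× / F^{× ℓ^n}` of the group of roots of unity of `ℓ`-power order of `F`.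
The image of this finite `ℓ`-group (for `F` a local field) is already a `ℤ_ℓ`-submodule. -/
def localMu (ℓ : ℕ) [Fact ℓ.Prime] (F : Type*) [Field F] : Submodule ℤ_[ℓ] (ProMul ℓ F) :=
  Submodule.span ℤ_[ℓ]
    {x | ∃ ζ ∈ CommGroup.primaryComponent Fˣ ℓ,
      x = AdicCompletion.of (Ideal.span {(ℓ : ℤ_[ℓ])}) (AdicMul ℓ F) (1 ⊗ₜ Additive.ofMul ζ)}

section NumberField

variable (ℓ : ℕ) [Fact ℓ.Prime] (K : Type*) [Field K] [NumberField K]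

/-- The finite places of `K` above `ℓ`. -/
abbrev PlaceAbove : Type _ := {v : HeightOneSpectrum (𝓞 K) // (ℓ : 𝓞 K) ∈ v.asIdeal}

/-- The finite places of `K` not above `ℓ`. -/
abbrev PlaceAway : Type _ := {v : HeightOneSpectrum (𝓞 K) // (ℓ : 𝓞 K) ∉ v.asIdeal}

/-- `D'_K`: the free `ℤ_ℓ`-module on the prime ideals of `K` that do not divide `ℓ`. -/
abbrev DivAway : Type _ := PlaceAway ℓ K →₀ ℤ_[ℓ]

/-- The normalised additive valuation of `x ∈ K^×` at a finite place `v`. -/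
def ord (v : HeightOneSpectrum (𝓞 K)) (x : Kˣ) : ℤ := -WithZero.log (v.valuation K (x : K))

variable {K} in
theorem ord_mul (v : HeightOneSpectrum (𝓞 K)) (x y : Kˣ) :
    ord K v (x * y) = ord K v x + ord K v y := by
  simp only [ord, Units.val_mul, map_mul]
  rw [WithZero.log_mul (by simp) (by simp)]
  ring

variable {K} in
theorem finite_ord_ne_zero (x : Kˣ) :
    {v : HeightOneSpectrum (𝓞 K) | ord K v x ≠ 0}.Finite := by
  refine ((HeightOneSpectrum.Support.finite (𝓞 K) (x : K)).union
    (HeightOneSpectrum.Support.finite (𝓞 K) ((x : K)⁻¹))).subset ?_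
  intro v hv
  have h0 : v.valuation K (x : K) ≠ 0 := by simp
  rcases lt_trichotomy (v.valuation K (x : K)) 1 with h | h | h
  · right
    change 1 < v.valuation K ((x : K)⁻¹)
    rw [map_inv₀]
    exact (one_lt_inv₀ (zero_lt_iff.2 h0)).2 h
  · exact absurd (by simp [ord, h]) hv
  · exact Or.inl h

/-- The prime-to-`ℓ` part of the divisor of `x ∈ K^×`. -/
def divAwayUnit : Additive Kˣ →+ DivAway ℓ K where
  toFun x := Finsupp.ofSupportFinite (fun v ↦ ((ord K v.1 x.toMul : ℤ) : ℤ_[ℓ]))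
    (((finite_ord_ne_zero x.toMul).preimage Subtype.val_injective.injOn).subset fun v hv h ↦
      hv (by simp [h]))
  map_zero' := by
    ext v
    simp [Finsupp.ofSupportFinite, ord]
  map_add' x y := by
    ext v
    change ((ord K v.1 (x.toMul * y.toMul) : ℤ) : ℤ_[ℓ]) =
      ((ord K v.1 x.toMul : ℤ) : ℤ_[ℓ]) + ((ord K v.1 y.toMul : ℤ) : ℤ_[ℓ])
    rw [ord_mul, Int.cast_add]

/-- The divisor map `R_K → D'_K`. -/
def divAway : AdicMul ℓ K →ₗ[ℤ_[ℓ]] DivAway ℓ K :=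
  (divAwayUnit ℓ K).toIntLinearMap.liftBaseChange ℤ_[ℓ]

/-- The localisation map `R_K → R_{K_v} = lim K_v^× / K_v^{× ℓ^n}`. -/
def localize (v : HeightOneSpectrum (𝓞 K)) :
    AdicMul ℓ K →ₗ[ℤ_[ℓ]] ProMul ℓ (v.adicCompletion K) :=
  AdicCompletion.of (Ideal.span {(ℓ : ℤ_[ℓ])}) (AdicMul ℓ (v.adicCompletion K)) ∘ₗ
    AdicMul.map ℓ (algebraMap K (v.adicCompletion K))

/-- The semi-localisation map `R_K → ∏_{v ∣ ℓ} R_{K_v}`. -/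
def semilocalize :
    AdicMul ℓ K →ₗ[ℤ_[ℓ]] ∀ v : PlaceAbove ℓ K, ProMul ℓ (v.1.adicCompletion K) :=
  LinearMap.pi fun v ↦ localize ℓ K v.1

/-- Leopoldt's conjecture for the number field `K` and the prime `ℓ`:
the map `ℤ_ℓ ⊗ 𝓞_K^× → ∏_{v ∣ ℓ} R_{K_v}` is injective. -/
def Leopoldt : Prop :=
  Function.Injective (semilocalize ℓ K ∘ₗ
    (Units.map (algebraMap (𝓞 K) K : 𝓞 K →* K)).toAdditive.toIntLinearMap.baseChange ℤ_[ℓ])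

/-- `R_K^bp`: the pseudo-infinitesimal elements of `R_K`, i.e. those which are locally roots of
unity at the places above `ℓ`. -/
def pseudoInfinitesimal : Submodule ℤ_[ℓ] (AdicMul ℓ K) :=
  ⨅ v : PlaceAbove ℓ K, (localMu ℓ (v.1.adicCompletion K)).comap (localize ℓ K v.1)

/-- `P_K^bp`: the principal divisors generated by the pseudo-infinitesimal elements. -/
def principalBP : Submodule ℤ_[ℓ] (DivAway ℓ K) :=
  (pseudoInfinitesimal ℓ K).map (divAway ℓ K)

/-- `Cl_K^bp = D'_K / P_K^bp`: the group of pseudo-infinitesimal classes. -/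
abbrev ClassBP : Type _ := DivAway ℓ K ⧸ principalBP ℓ K

/-- The Bertrandias–Payan module `T_K^bp`: the `ℤ_ℓ`-torsion of `Cl_K^bp`. -/
def torsionBP : Submodule ℤ_[ℓ] (ClassBP ℓ K) := Submodule.torsion ℤ_[ℓ] (ClassBP ℓ K)

/-- `μ_K`: the group of roots of unity of `ℓ`-power order in `K`. -/
def mu : Subgroup Kˣ := CommGroup.primaryComponent Kˣ ℓ

end NumberField

section Extension

theorem natCast_mem_under_iff (ℓ : ℕ) (K L : Type*) [Field K] [Field L] [NumberField L]
    [Algebra K L] [NumberField K] (w : HeightOneSpectrum (𝓞 L)) :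
    (ℓ : 𝓞 K) ∈ (w.under (𝓞 K)).asIdeal ↔ (ℓ : 𝓞 L) ∈ w.asIdeal := by
  change (ℓ : 𝓞 K) ∈ w.asIdeal.under (𝓞 K) ↔ _
  rw [Ideal.mem_under, map_natCast]

variable (ℓ : ℕ) [Fact ℓ.Prime] (K L : Type*) [Field K] [NumberField K] [Field L] [NumberField L]
  [Algebra K L]

instance liesOver_under (w : HeightOneSpectrum (𝓞 L)) :
    w.asIdeal.LiesOver (w.under (𝓞 K)).asIdeal :=
  Ideal.over_under (A := 𝓞 K) w.asIdeal

/-- The place of `K` below a place of `L` not above `ℓ`. -/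
def placeUnder (w : PlaceAway ℓ L) : PlaceAway ℓ K :=
  ⟨w.1.under (𝓞 K), fun h ↦ w.2 ((natCast_mem_under_iff ℓ K L w.1).1 h)⟩

theorem finite_placeUnder_fiber (v : PlaceAway ℓ K) :
    {w : PlaceAway ℓ L | placeUnder ℓ K L w = v}.Finite := by
  have : v.1.asIdeal.IsMaximal := v.1.isMaximal
  refine ((IsDedekindDomain.primesOver_finite v.1.asIdeal (𝓞 L)).preimage
    (f := fun w : PlaceAway ℓ L ↦ w.1.asIdeal)
    (fun a _ b _ h ↦ Subtype.ext (HeightOneSpectrum.ext h))).subset ?_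
  rintro w rfl
  exact ⟨w.1.isPrime, liesOver_under K L w.1⟩

/-- The ramification index of a place `w` of `L` over the place of `K` below it. -/
def ramIdx (w : HeightOneSpectrum (𝓞 L)) : ℕ :=
  (w.under (𝓞 K)).asIdeal.ramificationIdx' w.asIdeal

/-- Extension of divisors `D'_K → D'_L`: it sends a prime `v` to `∑_{w ∣ v} e(w/v) w`, so that
the coefficient at `w` of the extension of `a` is `e(w/v) a_v`, where `v` lies below `w`. -/
def extDiv : DivAway ℓ K →ₗ[ℤ_[ℓ]] DivAway ℓ L where
  toFun a := Finsupp.ofSupportFinite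
    (fun w ↦ (ramIdx K L w.1 : ℤ_[ℓ]) * a (placeUnder ℓ K L w))
    ((a.support.finite_toSet.biUnion fun v _ ↦ finite_placeUnder_fiber ℓ K L v).subset
      fun w hw ↦ by
        simp only [Set.mem_iUnion]
        refine ⟨placeUnder ℓ K L w, ?_, rfl⟩
        simp only [Finset.mem_coe, Finsupp.mem_support_iff]
        exact right_ne_zero_of_mul hw)
  map_add' a b := by
    ext w
    simp [Finsupp.ofSupportFinite, mul_add]
  map_smul' c a := by
    ext w
    simp [Finsupp.ofSupportFinite, mul_left_comm]

theorem ord_map (w : HeightOneSpectrum (𝓞 L)) (x : Kˣ) :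
    ord L w (Units.map (algebraMap K L : K →* L) x) =
      ramIdx K L w * ord K (w.under (𝓞 K)) x := by
  have h := HeightOneSpectrum.valuation_liesOver (K := K) L (w.under (𝓞 K)) w (x : K)
  simp only [ord, Units.coe_map, MonoidHom.coe_coe]
  rw [← h, WithZero.log_pow, nsmul_eq_mul, ramIdx]
  ring

theorem divAway_map (x : AdicMul ℓ K) :
    divAway ℓ L (AdicMul.map ℓ (algebraMap K L) x) = extDiv ℓ K L (divAway ℓ K x) := by
  suffices h : divAway ℓ L ∘ₗ AdicMul.map ℓ (algebraMap K L) = extDiv ℓ K L ∘ₗ divAway ℓ K from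
    LinearMap.congr_fun h x
  refine TensorProduct.AlgebraTensorModule.curry_injective ?_
  ext x w
  simp only [divAway, AdicMul.map, TensorProduct.AlgebraTensorModule.curry_apply,
    TensorProduct.curry_apply, LinearMap.restrictScalars_apply,
    LinearMap.comp_apply, LinearMap.baseChange_tmul, LinearMap.liftBaseChange_tmul, one_smul]
  change ((ord L w.1 (Units.map (algebraMap K L : K →* L) x.toMul) : ℤ) : ℤ_[ℓ]) =
    (ramIdx K L w.1 : ℤ_[ℓ]) * ((ord K (w.1.under (𝓞 K)) x.toMul : ℤ) : ℤ_[ℓ])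
  rw [ord_map]
  push_cast
  rfl

/-- The embedding `K_v → L_w` of completions, where `v` is the place of `K` below `w`. -/
def completionMap (w : HeightOneSpectrum (𝓞 L)) :
    (w.under (𝓞 K)).adicCompletion K →+* w.adicCompletion L :=
  (HeightOneSpectrum.adicCompletion.equiv L w).symm.toRingHom.comp
    ((UniformSpace.Completion.mapRingHom _
      (HeightOneSpectrum.uniformContinuous_algebraMap_liesOver K L
        (w.under (𝓞 K)) w).continuous).comp
      (HeightOneSpectrum.adicCompletion.equiv K (w.under (𝓞 K))).toRingHom)

theorem completionMap_algebraMap (w : HeightOneSpectrum (𝓞 L)) (x : K) :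
    completionMap K L w (algebraMap K _ x) = algebraMap L _ (algebraMap K L x) := by
  apply HeightOneSpectrum.adicCompletion.ext
  exact UniformSpace.Completion.mapRingHom_coe
    (HeightOneSpectrum.uniformContinuous_algebraMap_liesOver K L (w.under (𝓞 K)) w).continuous
    (WithVal.toVal ((w.under (𝓞 K)).valuation K) x)

theorem AdicMul.map_comp {F E M : Type*} [Field F] [Field E] [Field M] (f : F →+* E) (g : E →+* M)
    (x : AdicMul ℓ F) : AdicMul.map ℓ g (AdicMul.map ℓ f x) = AdicMul.map ℓ (g.comp f) x := by
  suffices h : AdicMul.map ℓ g ∘ₗ AdicMul.map ℓ f = AdicMul.map ℓ (g.comp f) from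
    LinearMap.congr_fun h x
  refine TensorProduct.AlgebraTensorModule.curry_injective ?_
  ext x
  simp [AdicMul.map]
  rfl

theorem localMu_map {F E : Type*} [Field F] [Field E] (f : F →+* E) {x : ProMul ℓ F}
    (hx : x ∈ localMu ℓ F) :
    AdicCompletion.map (Ideal.span {(ℓ : ℤ_[ℓ])}) (AdicMul.map ℓ f) x ∈ localMu ℓ E := by
  induction hx using Submodule.span_induction with
  | mem x hx =>
    obtain ⟨ζ, ⟨k, hk⟩, rfl⟩ := hx
    refine Submodule.subset_span ⟨Units.map (f : F →* E) ζ, ⟨k, ?_⟩, ?_⟩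
    · rw [← map_pow, hk, map_one]
    · rw [AdicCompletion.map_of]
      simp [AdicMul.map]
  | zero => simp
  | add x y _ _ hx hy => rw [map_add]; exact add_mem hx hy
  | smul a x _ hx =>
    have := LinearMap.map_smul_of_tower
      (AdicCompletion.map (Ideal.span {(ℓ : ℤ_[ℓ])}) (AdicMul.map ℓ f)) a x
    rw [this]
    exact Submodule.smul_mem _ _ hx

theorem localize_map (w : HeightOneSpectrum (𝓞 L)) (x : AdicMul ℓ K) :
    localize ℓ L w (AdicMul.map ℓ (algebraMap K L) x) =
      AdicCompletion.map (Ideal.span {(ℓ : ℤ_[ℓ])}) (AdicMul.map ℓ (completionMap K L w))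
        (localize ℓ K (w.under (𝓞 K)) x) := by
  simp only [localize, LinearMap.comp_apply, AdicCompletion.map_of, AdicMul.map_comp]
  congr 2
  congr 1
  exact RingHom.ext fun y ↦ (completionMap_algebraMap K L w y).symm

theorem map_mem_pseudoInfinitesimal {x : AdicMul ℓ K} (hx : x ∈ pseudoInfinitesimal ℓ K) :
    AdicMul.map ℓ (algebraMap K L) x ∈ pseudoInfinitesimal ℓ L := by
  simp only [pseudoInfinitesimal, Submodule.mem_iInf, Submodule.mem_comap] at hx ⊢
  intro w
  rw [localize_map]
  exact localMu_map ℓ _ (hx ⟨w.1.under (𝓞 K), (natCast_mem_under_iff ℓ K L w.1).2 w.2⟩)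

theorem principalBP_le_comap :
    principalBP ℓ K ≤ (principalBP ℓ L).comap (extDiv ℓ K L) := by
  rintro _ ⟨x, hx, rfl⟩
  exact ⟨_, map_mem_pseudoInfinitesimal ℓ K L hx, divAway_map ℓ K L x⟩

/-- The extension map `Cl_K^bp → Cl_L^bp` induced by the extension of divisors. -/
def extClass : ClassBP ℓ K →ₗ[ℤ_[ℓ]] ClassBP ℓ L :=
  Submodule.mapQ _ _ (extDiv ℓ K L) (principalBP_le_comap ℓ K L)

/-- The extension map `T_K^bp → T_L^bp`, the restriction of the extension map of classes. -/
def extTorsion : torsionBP ℓ K →ₗ[ℤ_[ℓ]] torsionBP ℓ L :=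
  (extClass ℓ K L).restrict fun x hx ↦ by
    obtain ⟨a, ha⟩ := hx
    exact ⟨a, by rw [Submonoid.smul_def] at ha ⊢; rw [← map_smul, ha, map_zero]⟩

end Extension

end BertrandiasPayan

end

/-!
Write `R_K` for `ℤ_ℓ ⊗ K^×`, and `R_K^bp` for its submodule of pseudo-infinitesimal elements.

The idea is Galois descent in torsion-free modules. Since `L/K` is an `ℓ`-extension, `μ_K = 1` forces
`μ_L = 1` (`mu_eq_bot_of_isPGroup`), and flatness of `ℤ_ℓ` shows that `R_L` is torsion-free and that
its Galois invariants are `R_K` (`AdicMul.exists_map_eq_of_fixed`). Under Leopoldt's conjecture the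
divisor map away from `ℓ` is injective on `R_L^bp` (`eq_zero_of_divAway_eq_zero`).

Let `a` be a divisor of `K` with `n a = div x`, `x ∈ R_K^bp`, `n ≠ 0`, whose extension to `L` is
`div y` with `y ∈ R_L^bp`. Then `n y` and `x` have the same divisor, so `n y = x` in `R_L`. The element
`y` is Galois invariant because `n y` is, hence comes from some `z ∈ R_K` with `n z = x` and
`div z = a`. It remains to see that `z` is pseudo-infinitesimal. This holds because `R_K / R_K^bp` is
torsion-free, which is a consequence of the local fact that all the torsion of the pro-`ℓ`-completion
of the multiplicative group of a field comes from roots of unity (`mem_localMu_iff`): a torsion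
element is, at each finite level, a root of unity of bounded order, and there are finitely many of
these. The same fact makes the valuations above `ℓ` vanish on `R_L^bp`, which is what allows
Leopoldt's conjecture, a statement about units, to be applied. Hence the extension map is injective,
and `T_L^bp` is nontrivial as soon as `T_K^bp` is.
-/

noncomputable section

namespace BertrandiasPayan

/-! ### Torsion in adic completions -/

/-- If the `r ^ m`-torsion of `M` is finite, every `r ^ m`-torsion element of the `r`-adic
completion of `M` comes from the `r ^ m`-torsion of `M`. -/
theorem exists_of_eq_of_pow_smul_eq_zero {R M : Type*} [CommRing R] [AddCommGroup M] [Module R M]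
    (r : R) (m : ℕ) (hfin : {y : M | r ^ m • y = 0}.Finite)
    (x : AdicCompletion (Ideal.span {r}) M) (hx : r ^ m • x = 0) :
    ∃ y : M, r ^ m • y = 0 ∧ AdicCompletion.of (Ideal.span {r}) M y = x := by
  have key : ∀ k : ℕ, ∃ y : M, r ^ m • y = 0 ∧
      AdicCompletion.eval (Ideal.span {r}) M k x = Submodule.mkQ _ y := by
    -- lift `x` modulo `r ^ (k + m)` to `z`; as `r ^ m • z = r ^ (k + m) • u`, the element
    -- `z - r ^ k • u` is torsion and agrees with `x` modulo `r ^ k`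
    intro k
    obtain ⟨z, hz⟩ := Submodule.mkQ_surjective _ (AdicCompletion.eval (Ideal.span {r}) M (k + m) x)
    have h1 : r ^ m • z ∈ (Ideal.span {r} ^ (k + m) • ⊤ : Submodule R M) := by
      rw [← Submodule.Quotient.mk_eq_zero, ← Submodule.mkQ_apply, map_smul, hz, ← map_smul, hx,
        map_zero]
    rw [Ideal.span_singleton_pow, Submodule.ideal_span_singleton_smul,
      Submodule.mem_smul_pointwise_iff_exists] at h1
    obtain ⟨u, -, hu⟩ := h1
    have h2 : r ^ k • u ∈ (Ideal.span {r} ^ k • ⊤ : Submodule R M) :=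
      Submodule.smul_mem_smul (Ideal.pow_mem_pow (Ideal.mem_span_singleton_self r) k) trivial
    refine ⟨z - r ^ k • u, by rw [smul_sub, smul_smul, ← pow_add, add_comm m k, hu, sub_self], ?_⟩
    rw [map_sub, Submodule.mkQ_apply (x := r ^ k • u), (Submodule.Quotient.mk_eq_zero _).2 h2,
      sub_zero, AdicCompletion.eval_apply,
      ← AdicCompletion.transitionMap_comp_eval_apply _ _ (Nat.le_add_right k m) x,
      ← AdicCompletion.eval_apply, ← hz]
    rfl
  choose y hy hxy using key
  -- by finiteness, one torsion element occurs for arbitrarily large `k`, hence works for all `n`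
  have : Finite {y : M | r ^ m • y = 0} := hfin
  obtain ⟨⟨y₀, hy₀⟩, hinf⟩ :=
    Finite.exists_infinite_fiber (fun k ↦ (⟨y k, hy k⟩ : {y : M | r ^ m • y = 0}))
  refine ⟨y₀, hy₀, AdicCompletion.ext fun n ↦ ?_⟩
  obtain ⟨k, hk, hnk⟩ := (Set.infinite_coe_iff.1 hinf).exists_gt n
  have hk' : y k = y₀ := congrArg Subtype.val hk
  have h2 := hxy k
  rw [hk'] at h2
  rw [← AdicCompletion.transitionMap_comp_eval_apply _ _ hnk.le x,
    ← AdicCompletion.eval_apply _ _ k x, h2]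
  rfl

/-! ### Exactness of `ℤ_ℓ ⊗ -` -/

section Tensor
variable (ℓ : ℕ) [Fact ℓ.Prime]

theorem exists_baseChange_eq {A B C : Type*} [AddCommGroup A] [AddCommGroup B] [AddCommGroup C]
    {f : A →ₗ[ℤ] B} {g : B →ₗ[ℤ] C} (h : Function.Exact f g) (x : ℤ_[ℓ] ⊗[ℤ] B)
    (hx : g.baseChange ℤ_[ℓ] x = 0) : ∃ y, f.baseChange ℤ_[ℓ] y = x :=
  (Module.Flat.lTensor_exact ℤ_[ℓ] h x).1 hx

/-- By flatness, the `ℓ ^ m`-torsion of `ℤ_ℓ ⊗ A` is `ℤ_ℓ ⊗ A[ℓ ^ m]`, which is `A[ℓ ^ m]`. -/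
theorem exists_one_tmul_eq {A : Type*} [AddCommGroup A] (m : ℕ) (x : ℤ_[ℓ] ⊗[ℤ] A)
    (hx : (ℓ : ℤ_[ℓ]) ^ m • x = 0) : ∃ a : A, ℓ ^ m • a = 0 ∧ x = 1 ⊗ₜ a := by
  set g : A →ₗ[ℤ] A := LinearMap.lsmul ℤ A ((ℓ : ℤ) ^ m)
  have hg : g.baseChange ℤ_[ℓ] x = 0 := by
    rw [← hx]
    clear hx
    induction x with
    | zero => simp
    | add x y hx hy => rw [map_add, hx, hy, smul_add]
    | tmul c a =>
      simp only [g, LinearMap.baseChange_tmul, LinearMap.lsmul_apply, TensorProduct.tmul_smul,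
        TensorProduct.smul_tmul', smul_eq_mul, zsmul_eq_mul]
      push_cast
      rfl
  obtain ⟨y, rfl⟩ := exists_baseChange_eq ℓ g.exact_subtype_ker_map x hg
  clear hg hx
  induction y with
  | zero => exact ⟨0, by simp⟩
  | add y z hy hz =>
    obtain ⟨a, ha, ha'⟩ := hy
    obtain ⟨b, hb, hb'⟩ := hz
    exact ⟨a + b, by rw [smul_add, ha, hb, add_zero],
      by rw [map_add, ha', hb', TensorProduct.tmul_add]⟩
  | tmul c a =>
    have ha : ℓ ^ m • (a : A) = 0 := by
      have := a.2
      simp only [g, LinearMap.mem_ker, LinearMap.lsmul_apply] at this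
      rw [← this, ← natCast_zsmul]; push_cast; rfl
    -- modulo `ℓ ^ m`, the coefficient `c` is a natural number
    obtain ⟨d, hd⟩ := Ideal.mem_span_singleton.1 (PadicInt.appr_spec m c)
    refine ⟨c.appr m • (a : A), by rw [smul_comm, ha, smul_zero], ?_⟩
    have h1 : c = ℓ ^ m • d + c.appr m • 1 := by
      rw [nsmul_eq_mul, nsmul_one, Nat.cast_pow, ← hd, sub_add_cancel]
    calc c ⊗ₜ[ℤ] (a : A) = (ℓ ^ m • d + c.appr m • 1) ⊗ₜ[ℤ] (a : A) := by rw [← h1]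
      _ = _ := by
        rw [TensorProduct.add_tmul, TensorProduct.smul_tmul, ha, TensorProduct.tmul_zero, zero_add,
          TensorProduct.smul_tmul]

theorem exists_pow_smul_eq_zero {M : Type*} [AddCommGroup M] [Module ℤ_[ℓ] M] {c : ℤ_[ℓ]}
    (hc : c ≠ 0) {x : M} (hx : c • x = 0) : ∃ m : ℕ, (ℓ : ℤ_[ℓ]) ^ m • x = 0 := by
  refine ⟨c.valuation, ?_⟩
  rw [PadicInt.unitCoeff_spec hc, mul_smul] at hx
  exact (IsUnit.smul_eq_zero (PadicInt.unitCoeff hc).isUnit).1 hx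

end Tensor

/-! ### Torsion of `ℤ_ℓ ⊗ F^×` and of the pro-`ℓ`-completion of `F^×` -/

section Field
variable (ℓ : ℕ) [Fact ℓ.Prime] (F : Type*) [Field F]

theorem AdicMul.exists_of_pow_smul_eq_zero (m : ℕ) (x : AdicMul ℓ F)
    (hx : (ℓ : ℤ_[ℓ]) ^ m • x = 0) :
    ∃ ζ : Fˣ, ζ ^ ℓ ^ m = 1 ∧ x = 1 ⊗ₜ Additive.ofMul ζ := by
  obtain ⟨a, ha, hx⟩ := exists_one_tmul_eq ℓ m x hx
  exact ⟨a.toMul, ha, hx⟩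

theorem AdicMul.eq_zero_of_smul_eq_zero (hF : CommGroup.primaryComponent Fˣ ℓ = ⊥)
    {c : ℤ_[ℓ]} (hc : c ≠ 0) {x : AdicMul ℓ F} (hx : c • x = 0) : x = 0 := by
  obtain ⟨m, hm⟩ := exists_pow_smul_eq_zero ℓ hc hx
  obtain ⟨ζ, hζ, rfl⟩ := exists_of_pow_smul_eq_zero ℓ F m x hm
  have : ζ ∈ CommGroup.primaryComponent Fˣ ℓ := ⟨m, hζ⟩
  rw [hF, Subgroup.mem_bot] at this
  simp [this]

theorem AdicMul.finite_pow_smul_eq_zero (m : ℕ) :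
    {x : AdicMul ℓ F | (ℓ : ℤ_[ℓ]) ^ m • x = 0}.Finite := by
  have : NeZero (ℓ ^ m) := ⟨pow_ne_zero _ (Fact.out : ℓ.Prime).ne_zero⟩
  refine (Set.finite_range fun ζ : rootsOfUnity (ℓ ^ m) F ↦
    (1 ⊗ₜ Additive.ofMul (ζ : Fˣ) : AdicMul ℓ F)).subset fun x hx ↦ ?_
  obtain ⟨ζ, hζ, rfl⟩ := exists_of_pow_smul_eq_zero ℓ F m x hx
  exact ⟨⟨ζ, hζ⟩, rfl⟩

/-- The roots of unity of `ℓ`-power order exhaust the torsion of the pro-`ℓ`-completion. -/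
theorem mem_localMu_iff (x : ProMul ℓ F) :
    x ∈ localMu ℓ F ↔ ∃ m : ℕ, (ℓ : ℤ_[ℓ]) ^ m • x = 0 := by
  constructor
  · intro hx
    induction hx using Submodule.span_induction with
    | mem x hx =>
      obtain ⟨ζ, ⟨k, hk⟩, rfl⟩ := hx
      refine ⟨k, ?_⟩
      have : ℓ ^ k • Additive.ofMul ζ = 0 := congrArg Additive.ofMul hk
      rw [← Nat.cast_pow, Nat.cast_smul_eq_nsmul, ← map_nsmul, ← TensorProduct.tmul_smul, this,
        TensorProduct.tmul_zero, map_zero]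
    | zero => exact ⟨0, smul_zero _⟩
    | add x y _ _ hx hy =>
      obtain ⟨m, hm⟩ := hx
      obtain ⟨n, hn⟩ := hy
      refine ⟨m + n, ?_⟩
      rw [smul_add, pow_add, mul_smul, mul_smul, hn, smul_comm, hm, smul_zero, smul_zero, add_zero]
    | smul a x _ hx =>
      obtain ⟨m, hm⟩ := hx
      exact ⟨m, by rw [smul_comm, hm, smul_zero]⟩
  · rintro ⟨m, hm⟩
    obtain ⟨y, hy, rfl⟩ := exists_of_eq_of_pow_smul_eq_zero (ℓ : ℤ_[ℓ]) m
      (AdicMul.finite_pow_smul_eq_zero ℓ F m) x hm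
    obtain ⟨ζ, hζ, rfl⟩ := AdicMul.exists_of_pow_smul_eq_zero ℓ F m y hy
    exact Submodule.subset_span ⟨ζ, ⟨m, hζ⟩, rfl⟩

variable {F} in
theorem AdicMul.map_injective {E : Type*} [Field E] (f : F →+* E) :
    Function.Injective (AdicMul.map ℓ f) :=
  Module.Flat.lTensor_preserves_injective_linearMap (M := ℤ_[ℓ])
    (Units.map (f : F →* E)).toAdditive.toIntLinearMap (Units.map_injective f.injective)

/-- The `ℤ_ℓ`-linear extension `ℤ_ℓ ⊗ F^× → ℤ_ℓ` of a homomorphism `F^× → ℤ`. -/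
def AdicMul.lift (φ : Additive Fˣ →+ ℤ) : AdicMul ℓ F →ₗ[ℤ_[ℓ]] ℤ_[ℓ] :=
  ((Int.castAddHom ℤ_[ℓ]).comp φ).toIntLinearMap.liftBaseChange ℤ_[ℓ]

variable {F} in
/-- A homomorphism `F^× → ℤ` extends to the pro-`ℓ`-completion, whose target `ℤ_ℓ` is
torsion-free, so that it kills the elements that are torsion in the completion. -/
theorem AdicMul.lift_eq_zero_of_of_mem_localMu (φ : Additive Fˣ →+ ℤ) {x : AdicMul ℓ F}
    (hx : AdicCompletion.of (Ideal.span {(ℓ : ℤ_[ℓ])}) (AdicMul ℓ F) x ∈ localMu ℓ F) :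
    AdicMul.lift ℓ F φ x = 0 := by
  obtain ⟨m, hm⟩ := (mem_localMu_iff ℓ F _).1 hx
  have hmap := AdicCompletion.map_of (Ideal.span {(ℓ : ℤ_[ℓ])}) (AdicMul.lift ℓ F φ)
    ((ℓ : ℤ_[ℓ]) ^ m • x)
  rw [map_smul _ _ x, hm, map_zero] at hmap
  have : IsHausdorff (Ideal.span {(ℓ : ℤ_[ℓ])}) ℤ_[ℓ] := by
    rw [← PadicInt.maximalIdeal_eq_span_p]; infer_instance
  have h0 := AdicCompletion.of_injective (Ideal.span {(ℓ : ℤ_[ℓ])}) ℤ_[ℓ]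
    (hmap.symm.trans (map_zero _).symm)
  rw [map_smul, smul_eq_mul] at h0
  exact (mul_eq_zero.1 h0).resolve_left
    (pow_ne_zero _ (Nat.cast_ne_zero.2 (Fact.out : ℓ.Prime).ne_zero))

end Field

/-! ### Valuations and units -/

section NumberField
variable (ℓ : ℕ) [Fact ℓ.Prime] (K : Type*) [Field K] [NumberField K]

/-- The valuation `ord K v` as a homomorphism. -/
def ordHom (v : HeightOneSpectrum (𝓞 K)) : Additive Kˣ →+ ℤ where
  toFun x := ord K v x.toMul
  map_zero' := by simp [ord]
  map_add' x y := ord_mul v x.toMul y.toMul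

/-- The normalised additive valuation of the completion at `v`. -/
def ordCompletion (v : HeightOneSpectrum (𝓞 K)) : Additive (v.adicCompletion K)ˣ →+ ℤ where
  toFun x := -WithZero.log (Valued.v (x.toMul : v.adicCompletion K))
  map_zero' := by simp
  map_add' x y := by
    simp only [toMul_add, Units.val_mul, map_mul]
    rw [WithZero.log_mul (by simp) (by simp)]
    ring

theorem lift_ordHom (v : HeightOneSpectrum (𝓞 K)) (x : AdicMul ℓ K) :
    AdicMul.lift ℓ K (ordHom K v) x = AdicMul.lift ℓ _ (ordCompletion K v)
      (AdicMul.map ℓ (algebraMap K (v.adicCompletion K)) x) := by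
  induction x using TensorProduct.induction_on with
  | zero => simp
  | add x y hx hy => simp only [map_add, hx, hy]
  | tmul c a =>
    have : ordHom K v a = ordCompletion K v
        ((Units.map (algebraMap K (v.adicCompletion K) : K →* v.adicCompletion K)).toAdditive a) :=
      congrArg (fun y ↦ -WithZero.log y)
        (HeightOneSpectrum.valuedAdicCompletion_eq_valuation' v (a.toMul : K)).symm
    simp [AdicMul.lift, AdicMul.map, this]

theorem divAway_apply (x : AdicMul ℓ K) (v : PlaceAway ℓ K) :
    divAway ℓ K x v = AdicMul.lift ℓ K (ordHom K v.1) x := by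
  induction x using TensorProduct.induction_on with
  | zero => simp
  | add x y hx hy => simp only [map_add, Finsupp.add_apply, hx, hy]
  | tmul c a => simp [divAway, AdicMul.lift]; left; rfl

/-- The divisor of an element of `K^×`. -/
def divisor : Additive Kˣ →ₗ[ℤ] HeightOneSpectrum (𝓞 K) →₀ ℤ :=
  AddMonoidHom.toIntLinearMap
    { toFun := fun x ↦ Finsupp.ofSupportFinite (fun v ↦ ordHom K v x)
        (finite_ord_ne_zero x.toMul)
      map_zero' := by ext v; simp [Finsupp.ofSupportFinite]
      map_add' := fun x y ↦ by ext v; exact map_add (ordHom K v) x y }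

/-- The sequence `𝓞_K^× → K^× → ⨁_v ℤ` is exact in the middle. -/
theorem exact_units_divisor :
    Function.Exact (Units.map (algebraMap (𝓞 K) K : 𝓞 K →* K)).toAdditive.toIntLinearMap
      (divisor K) := by
  have key (x : Kˣ) : divisor K (Additive.ofMul x) = 0 ↔
      ∀ v : HeightOneSpectrum (𝓞 K), v.valuation K (x : K) = 1 := by
    rw [Finsupp.ext_iff]
    refine forall_congr' fun v ↦ ?_
    change -WithZero.log (v.valuation K (x : K)) = 0 ↔ _
    refine ⟨fun h ↦ ?_, fun h ↦ by rw [h, WithZero.log_one, neg_zero]⟩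
    rw [← WithZero.exp_log (x := v.valuation K (x : K)) (by simp), neg_eq_zero.1 h,
      WithZero.exp_zero]
  intro x
  refine (key x.toMul).trans ⟨fun h ↦ ?_, ?_⟩
  · obtain ⟨a, ha⟩ := HeightOneSpectrum.mem_integers_of_valuation_le_one K
      (x.toMul : K) fun v ↦ (h v).le
    obtain ⟨b, hb⟩ := HeightOneSpectrum.mem_integers_of_valuation_le_one K
      ((x.toMul⁻¹ : Kˣ) : K) fun v ↦ by rw [Units.val_inv_eq_inv_val, map_inv₀, h v, inv_one]
    have hab : a * b = 1 := by
      apply FaithfulSMul.algebraMap_injective (𝓞 K) K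
      rw [map_mul, map_one, ha, hb, Units.mul_inv]
    exact ⟨Additive.ofMul ⟨a, b, hab, by rw [mul_comm, hab]⟩, Units.ext ha⟩
  · rintro ⟨u, rfl⟩ v
    change v.valuation K (algebraMap (𝓞 K) K (u.toMul : 𝓞 K)) = 1
    rw [HeightOneSpectrum.valuation_of_algebraMap]
    exact (v.intValuation_eq_one_iff).2 fun h ↦
      v.isPrime.ne_top (Ideal.eq_top_of_isUnit_mem _ h u.toMul.isUnit)

/-- An element of `ℤ_ℓ ⊗ K^×` all of whose valuations vanish comes from `ℤ_ℓ ⊗ 𝓞_K^×`. -/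
theorem exists_unit_of_lift_ordHom_eq_zero (x : AdicMul ℓ K)
    (hx : ∀ v, AdicMul.lift ℓ K (ordHom K v) x = 0) :
    ∃ e, (Units.map (algebraMap (𝓞 K) K : 𝓞 K →* K)).toAdditive.toIntLinearMap.baseChange
      ℤ_[ℓ] e = x := by
  classical
  refine exists_baseChange_eq ℓ (exact_units_divisor K) x ?_
  apply (TensorProduct.finsuppScalarRight ℤ ℤ_[ℓ] ℤ_[ℓ] (HeightOneSpectrum (𝓞 K))).injective
  rw [map_zero]
  ext v
  rw [Finsupp.zero_apply, ← hx v]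
  clear hx
  induction x using TensorProduct.induction_on with
  | zero => simp
  | add x y hx hy => simp only [map_add, Finsupp.add_apply, hx, hy]
  | tmul c a =>
    simp only [LinearMap.baseChange_tmul, TensorProduct.finsuppScalarRight_apply_tmul_apply,
      AdicMul.lift, LinearMap.liftBaseChange_tmul]
    rw [zsmul_eq_mul, mul_comm]
    rfl

/-- Pseudo-infinitesimal elements are those whose localisations above `ℓ` are torsion. -/
theorem mem_pseudoInfinitesimal_iff (x : AdicMul ℓ K) :
    x ∈ pseudoInfinitesimal ℓ K ↔ ∀ v : PlaceAbove ℓ K, ∃ m : ℕ,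
      localize ℓ K v.1 ((ℓ : ℤ_[ℓ]) ^ m • x) = 0 := by
  simp only [pseudoInfinitesimal, Submodule.mem_iInf, Submodule.mem_comap, mem_localMu_iff, map_smul]

theorem mem_pseudoInfinitesimal_of_smul_mem {c : ℤ_[ℓ]} (hc : c ≠ 0) {x : AdicMul ℓ K}
    (hx : c • x ∈ pseudoInfinitesimal ℓ K) : x ∈ pseudoInfinitesimal ℓ K := by
  rw [mem_pseudoInfinitesimal_iff] at hx ⊢
  intro v
  obtain ⟨m, hm⟩ := hx v
  rw [smul_smul, map_smul] at hm
  obtain ⟨n, hn⟩ := exists_pow_smul_eq_zero ℓ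
    (mul_ne_zero (pow_ne_zero m (Nat.cast_ne_zero.2 (Fact.out : ℓ.Prime).ne_zero)) hc) hm
  exact ⟨n, by rw [map_smul, hn]⟩

instance : Finite (PlaceAbove ℓ K) := by
  have h0 : Ideal.span {(ℓ : 𝓞 K)} ≠ 0 := by
    simpa using (Fact.out : ℓ.Prime).ne_zero
  refine ((Ideal.finite_factors h0).subset fun v hv ↦ ?_ :
    {v : HeightOneSpectrum (𝓞 K) | (ℓ : 𝓞 K) ∈ v.asIdeal}.Finite)
  exact Ideal.dvd_span_singleton.2 hv

/-- Under Leopoldt's conjecture, when `μ_K` is trivial, a pseudo-infinitesimal element with trivial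
divisor away from `ℓ` is trivial: it is locally torsion above `ℓ`, so all its valuations vanish, it
is a unit, and Leopoldt's conjecture makes it torsion. -/
theorem eq_zero_of_divAway_eq_zero (hμ : mu ℓ K = ⊥) (hK : Leopoldt ℓ K) {x : AdicMul ℓ K}
    (hx : x ∈ pseudoInfinitesimal ℓ K) (hdiv : divAway ℓ K x = 0) : x = 0 := by
  have hℓ : (ℓ : ℤ_[ℓ]) ≠ 0 := Nat.cast_ne_zero.2 (Fact.out : ℓ.Prime).ne_zero
  have hord (v) : AdicMul.lift ℓ K (ordHom K v) x = 0 := by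
    by_cases hv : (ℓ : 𝓞 K) ∈ v.asIdeal
    · rw [lift_ordHom]
      simp only [pseudoInfinitesimal, Submodule.mem_iInf, Submodule.mem_comap] at hx
      exact AdicMul.lift_eq_zero_of_of_mem_localMu ℓ _ (hx ⟨v, hv⟩)
    · rw [← divAway_apply ℓ K x ⟨v, hv⟩, hdiv, Finsupp.zero_apply]
  obtain ⟨e, rfl⟩ := exists_unit_of_lift_ordHom_eq_zero ℓ K x hord
  choose m hm using (mem_pseudoInfinitesimal_iff ℓ K _).1 hx
  obtain ⟨n, hn⟩ := (Set.finite_range m).bddAbove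
  have hs : (ℓ : ℤ_[ℓ]) ^ n • e = 0 := by
    refine hK ?_
    rw [map_zero]
    funext v
    rw [LinearMap.comp_apply, map_smul]
    change localize ℓ K v.1 _ = 0
    rw [← Nat.sub_add_cancel (hn ⟨v, rfl⟩ : m v ≤ n), pow_add, mul_smul, map_smul, hm v, smul_zero]
  refine AdicMul.eq_zero_of_smul_eq_zero ℓ K hμ (pow_ne_zero n hℓ) ?_
  rw [← map_smul, hs, map_zero]

end NumberField

/-! ### Galois descent and extension of classes -/

section Extension
variable (ℓ : ℕ) [Fact ℓ.Prime]

/-- The `ℤ_ℓ`-module `ℤ_ℓ ⊗ K^×` is the module of Galois invariants of `ℤ_ℓ ⊗ L^×`. -/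
theorem AdicMul.exists_map_eq_of_fixed (K L : Type*) [Field K] [Field L] [Algebra K L]
    [FiniteDimensional K L] [IsGalois K L] (y : AdicMul ℓ L)
    (hy : ∀ σ : L ≃ₐ[K] L, AdicMul.map ℓ (σ : L →+* L) y = y) :
    ∃ z : AdicMul ℓ K, AdicMul.map ℓ (algebraMap K L) z = y := by
  classical
  let a (σ : L ≃ₐ[K] L) : Additive Lˣ →ₗ[ℤ] Additive Lˣ :=
    (Units.map ((σ : L →+* L) : L →* L)).toAdditive.toIntLinearMap - LinearMap.id
  have hexact : Function.Exact
      (Units.map (algebraMap K L : K →* L)).toAdditive.toIntLinearMap (LinearMap.pi a) := by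
    intro x
    have h1 : LinearMap.pi a x = 0 ↔ ∀ σ : L ≃ₐ[K] L, σ (x.toMul : L) = x.toMul := by
      rw [funext_iff]
      refine forall_congr' fun σ ↦ ?_
      rw [LinearMap.pi_apply, Pi.zero_apply, LinearMap.sub_apply, sub_eq_zero]
      exact Units.ext_iff
    rw [h1, ← IsGalois.mem_range_algebraMap_iff_fixed]
    constructor
    · rintro ⟨k, hk⟩
      have hk0 : k ≠ 0 := by
        rintro rfl
        exact x.toMul.ne_zero (by rw [← hk, map_zero])
      exact ⟨Additive.ofMul (Units.mk0 k hk0), Units.ext hk⟩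
    · rintro ⟨u, rfl⟩
      exact ⟨(u.toMul : K), rfl⟩
  refine exists_baseChange_eq ℓ hexact y ?_
  apply (TensorProduct.piRight ℤ ℤ_[ℓ] ℤ_[ℓ] fun _ : L ≃ₐ[K] L ↦ Additive Lˣ).injective
  rw [map_zero]
  funext σ
  rw [Pi.zero_apply, ← sub_eq_zero.2 (hy σ)]
  clear hy
  induction y using TensorProduct.induction_on with
  | zero => simp
  | add x y hx hy => simp only [map_add, Pi.add_apply, hx, hy]; abel
  | tmul c u => simp [a, AdicMul.map, TensorProduct.tmul_sub]

/-- An `ℓ`-extension creates no root of unity of order `ℓ`, whose degree over `K` is less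
than `ℓ`. -/
theorem mu_eq_bot_of_isPGroup (K L : Type*) [Field K] [NumberField K]
    [Field L] [NumberField L] [Algebra K L] [IsGalois K L] (hμ : mu ℓ K = ⊥)
    (hG : IsPGroup ℓ (L ≃ₐ[K] L)) : mu ℓ L = ⊥ := by
  have hp : ℓ.Prime := Fact.out
  by_contra hne
  obtain ⟨ξ, ⟨k, hk⟩, hξ⟩ := (mu ℓ L).bot_or_exists_ne_one.resolve_left hne
  obtain ⟨j, -, hj⟩ := (Nat.dvd_prime_pow hp).1 (orderOf_dvd_of_pow_eq_one hk)
  have hj0 : j ≠ 0 := by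
    rintro rfl
    exact hξ (orderOf_eq_one_iff.1 hj)
  obtain ⟨i, rfl⟩ := Nat.exists_eq_succ_of_ne_zero hj0
  have hζ : IsPrimitiveRoot ((ξ ^ ℓ ^ i : Lˣ) : L) ℓ := by
    rw [IsPrimitiveRoot.coe_units_iff]
    have h := IsPrimitiveRoot.orderOf ξ
    rw [hj] at h
    exact h.pow (pow_pos hp.pos _) (pow_succ _ _)
  set ζ : L := ((ξ ^ ℓ ^ i : Lˣ) : L)
  have hint : IsIntegral K ζ := Algebra.IsIntegral.isIntegral ζ
  have hlt : (minpoly K ζ).natDegree < ℓ := by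
    have hdvd : minpoly K ζ ∣ Polynomial.cyclotomic ℓ K := by
      apply minpoly.dvd
      rw [Polynomial.aeval_def, Polynomial.eval₂_eq_eval_map, Polynomial.map_cyclotomic]
      exact hζ.isRoot_cyclotomic hp.pos
    refine (Polynomial.natDegree_le_of_dvd hdvd (Polynomial.cyclotomic_ne_zero _ _)).trans_lt ?_
    rw [Polynomial.natDegree_cyclotomic, Nat.totient_prime hp]
    exact Nat.sub_lt hp.pos one_pos
  obtain ⟨n, hn⟩ := IsPGroup.iff_card.1 hG
  rw [IsGalois.card_aut_eq_finrank] at hn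
  obtain ⟨r, -, hr⟩ := (Nat.dvd_prime_pow hp).1 (hn ▸ minpoly.degree_dvd hint)
  have hr0 : r = 0 := by
    by_contra h
    exact absurd hlt (not_lt.2 (hr ▸ Nat.le_self_pow h ℓ))
  rw [hr0, pow_zero, minpoly.natDegree_eq_one_iff] at hr
  obtain ⟨c, hc⟩ := hr
  have hcp : IsPrimitiveRoot c ℓ :=
    IsPrimitiveRoot.of_map_of_injective (f := algebraMap K L) (hc ▸ hζ) (algebraMap K L).injective
  have hmem : (hcp.isUnit hp.ne_zero).unit ∈ mu ℓ K :=
    ⟨1, Units.ext (by simpa using hcp.pow_eq_one)⟩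
  rw [hμ, Subgroup.mem_bot] at hmem
  exact hcp.ne_one hp.one_lt (congrArg Units.val hmem)

variable (K L : Type*) [Field K] [NumberField K] [Field L] [NumberField L] [Algebra K L]

theorem placeUnder_surjective : Function.Surjective (placeUnder ℓ K L) := by
  intro v
  have : v.1.asIdeal.IsMaximal := v.1.isMaximal
  obtain ⟨P, hP, hPv⟩ := Ideal.exists_maximal_ideal_liesOver_of_isIntegral (S := 𝓞 L) v.1.asIdeal
  have hP0 : P ≠ ⊥ := Ideal.ne_bot_of_liesOver_of_ne_bot v.1.ne_bot P
  have hu : HeightOneSpectrum.under (𝓞 K) ⟨P, hP.isPrime, hP0⟩ = v.1 :=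
    HeightOneSpectrum.ext hPv.over.symm
  refine ⟨⟨⟨P, hP.isPrime, hP0⟩, fun h ↦ v.2 ?_⟩, Subtype.ext hu⟩
  rw [← hu]
  exact (natCast_mem_under_iff ℓ K L _).2 h

theorem extDiv_injective : Function.Injective (extDiv ℓ K L) := by
  rw [injective_iff_map_eq_zero]
  intro a ha
  ext v
  obtain ⟨w, rfl⟩ := placeUnder_surjective ℓ K L v
  have h : (ramIdx K L w.1 : ℤ_[ℓ]) * a (placeUnder ℓ K L w) = 0 := DFunLike.congr_fun ha w
  refine (mul_eq_zero.1 h).resolve_left (Nat.cast_ne_zero.2 ?_)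
  exact Ideal.IsDedekindDomain.ramificationIdx'_ne_zero_of_liesOver _ (w.1.under (𝓞 K)).ne_bot

/-- If `a` becomes the divisor of a pseudo-infinitesimal `y` of `L` and `n • a` is the divisor of a
pseudo-infinitesimal `x` of `K`, then `n • y = x`, so `y` descends to `K`. -/
theorem extTorsion_injective [IsGalois K L] (hμ : mu ℓ L = ⊥) (hL : Leopoldt ℓ L) :
    Function.Injective (extTorsion ℓ K L) := by
  rw [injective_iff_map_eq_zero]
  rintro ⟨q, n, hn⟩ hq
  obtain ⟨a, rfl⟩ := Submodule.Quotient.mk_surjective _ q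
  have hn0 : (n : ℤ_[ℓ]) ≠ 0 := nonZeroDivisors.ne_zero n.2
  rw [Submonoid.smul_def, ← Submodule.Quotient.mk_smul, Submodule.Quotient.mk_eq_zero] at hn
  obtain ⟨x, hx, hxa⟩ := hn
  have hq' : (Submodule.Quotient.mk (extDiv ℓ K L a) : ClassBP ℓ L) = 0 := congrArg Subtype.val hq
  obtain ⟨y, hy, hya⟩ := (Submodule.Quotient.mk_eq_zero _).1 hq'
  have hxL := map_mem_pseudoInfinitesimal ℓ K L hx
  have hny : (n : ℤ_[ℓ]) • y = AdicMul.map ℓ (algebraMap K L) x := by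
    refine sub_eq_zero.1 (eq_zero_of_divAway_eq_zero ℓ L hμ hL
      (sub_mem (Submodule.smul_mem _ _ hy) hxL) ?_)
    rw [map_sub, map_smul, hya, divAway_map, hxa, map_smul, sub_self]
  -- `y` is Galois invariant, since so is `n • y` and there is no torsion
  have hfix (σ : L ≃ₐ[K] L) : AdicMul.map ℓ (σ : L →+* L) y = y := by
    refine sub_eq_zero.1 (AdicMul.eq_zero_of_smul_eq_zero ℓ L hμ hn0 ?_)
    rw [smul_sub, ← map_smul, hny, AdicMul.map_comp, sub_eq_zero]
    congr 2
    ext k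
    simp
  obtain ⟨z, rfl⟩ := AdicMul.exists_map_eq_of_fixed ℓ K L y hfix
  rw [← map_smul] at hny
  have hz : z ∈ pseudoInfinitesimal ℓ K := by
    refine mem_pseudoInfinitesimal_of_smul_mem ℓ K hn0 ?_
    rwa [AdicMul.map_injective ℓ _ hny]
  refine Subtype.ext ((Submodule.Quotient.mk_eq_zero _).2 ⟨z, hz, extDiv_injective ℓ K L ?_⟩)
  rw [← divAway_map, hya]

end Extension

end BertrandiasPayan

end

theorem mainTheorem9 (ℓ : ℕ) [Fact ℓ.Prime] (hℓ : ℓ ≠ 2)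
    (K : Type*) [Field K] [NumberField K]
    (hμ : BertrandiasPayan.mu ℓ K = ⊥) (hT : BertrandiasPayan.torsionBP ℓ K ≠ ⊥)
    (L : Type*) [Field L] [NumberField L] [Algebra K L] [IsGalois K L]
    (hG : IsPGroup ℓ (L ≃ₐ[K] L))
    (hL : BertrandiasPayan.Leopoldt ℓ L) :
    BertrandiasPayan.mu ℓ L = ⊥ ∧ BertrandiasPayan.torsionBP ℓ L ≠ ⊥ ∧
      Function.Injective (BertrandiasPayan.extTorsion ℓ K L) := by
  have hμL := BertrandiasPayan.mu_eq_bot_of_isPGroup ℓ K L hμ hG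
  have hinj := BertrandiasPayan.extTorsion_injective ℓ K L hμL hL
  refine ⟨hμL, fun h ↦ hT ?_, hinj⟩
  have : Subsingleton (BertrandiasPayan.torsionBP ℓ L) := Submodule.subsingleton_iff_eq_bot.2 h
  exact Submodule.subsingleton_iff_eq_bot.1 hinj.subsingleton
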